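/- **Almost sure asymptotic synchronization.** Let $N\ge 2$, $\alpha,\beta\in[0,1)$ with $\alpha+\beta\in(0,1)$, $q\in(0,1]$, let $f:[0,1]\to[0,1]$ be strictly increasing and of class $C^1$ on $[0,1]$, and let $(r_n)_{n\ge 0}$ be real numbers with $\lim_{n\to\infty} n\,r_n=1$. On a probability space let $Z_{n,h}$ ($n\ge0$, $1\le h\le N$) be random variables with values in $[0,1]$ and $I_{n,h}$ ($n\ge1$, $1\le h\le N$) random variables with values in $\{0,1\}$ such that, with $\mathcal F_n=\sigma(Z_{0,h},\,I_{k,h}:1\le k\le n,\,1\le h\le N)$ and $Z_n=\frac1N\sum_{i=1}^N Z_{n,i}$, for all $n\ge 0$ the variables $I_{n+1,1},\dots,I_{n+1,N}$ are conditionally independent given $\mathcal F_n$ and, for all $h$, $$P(I_{n+1,h}=1\mid\mathcal F_n)=\alpha Z_n+\beta q+(1-\alpha-\beta)f(Z_{n,h})\ \text{ a.s.},\qquad Z_{n+1,h}=(1-r_n)Z_{n,h}+r_nI_{n+1,h}.$$ Put $\mathbf Z_n=(Z_{n,1},\dots,Z_{n,N})$, $\mathbf 1=(1,\dots,1)$,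 $\mathbf F(\mathbf z)=(F_1(\mathbf z),\dots,F_N(\mathbf z))$ with $$F_h(\mathbf z)=\frac{\alpha}{N}\sum_{i=1}^N z_i+\beta q+(1-\alpha-\beta)f(z_h)-z_h,\qquad \mathbf z\in[0,1]^N,$$ and $\mathcal Z(\mathbf F)=\{\mathbf z\in[0,1]^N:\mathbf F(\mathbf z)=\mathbf 0\}$. Call a point of $\mathcal Z(\mathbf F)$ of the form $z\mathbf 1$, $z\in[0,1]$, a synchronization point. Assume that $\mathcal Z(\mathbf F)$ contains only finitely many synchronization points, that $f$ has a primitive on $[0,1]$, and that for every $c\in\left(-\frac{\alpha+\beta}{1-\alpha-\beta},0\right)$ the function $$\widetilde\varphi(z)=f(z)-\frac{1}{1-\alpha-\beta}\,z-c$$ has at most one zero in $[0,1]$; in the degenerate case where both $\alpha=0$ and $q=1$, assume this also for the left endpoint $c=-\frac{\alpha+\beta}{1-\alpha-\beta}$. Then every point of $\mathcal Z(\mathbf F)$ is a synchronization point, and there is a random variable $Z_\infty$ with values in $[0,1]$ such that $\mathbf Z_n\to Z_\infty\mathbf 1$ almost surely and $$\varphi(Z_\infty)=f(Z_\infty)-\frac{1-\alpha}{1-\alpha-\beta}\,Z_\infty+\frac{\beta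 q}{1-\alpha-\beta}=0 .$$ -/

import Mathlib

open MeasureTheory ProbabilityTheory Filter Topology Set

namespace ReinforcedSync

/-- The components of `X` are conditionally independent given the σ-field `m`: for all finite
families of components and all Borel sets, the conditional probability of the intersection is
almost surely the product of the conditional probabilities. -/
def CondIndepGiven {Ω : Type*} [MeasurableSpace Ω] (μ : Measure Ω) {N : ℕ}
    (m : MeasurableSpace Ω) (X : Fin N → Ω → ℝ) : Prop :=
  ∀ (s : Finset (Fin N)) (B : Fin N → Set ℝ), (∀ h, MeasurableSet (B h)) →
    μ⟦⋂ h ∈ s, X h ⁻¹' B h|m⟧ =ᵐ[μ] ∏ h ∈ s, μ⟦X h ⁻¹' B h|m⟧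

/-- The past information up to time `n`: the σ-field generated by the initial states `Z 0 h`
and by the actions `I k h` with `1 ≤ k ≤ n`. -/
abbrev past {Ω : Type*} {N : ℕ} (I Z : ℕ → Fin N → Ω → ℝ) (n : ℕ) : MeasurableSpace Ω :=
  (⨆ h, MeasurableSpace.comap (Z 0 h) inferInstance) ⊔
    ⨆ k ∈ Set.Icc 1 n, ⨆ h, MeasurableSpace.comap (I k h) inferInstance

/-- The arithmetic mean of the components of a vector. -/
noncomputable def avg {N : ℕ} (z : Fin N → ℝ) : ℝ := (∑ i, z i) / N

/-- The interacting system of reinforced stochastic processes on `(Ω, μ)`, with `N` units,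
parameters `α`, `β`, `q`, reinforcement function `f`, weights `r`, actions `I n h` (for `n ≥ 1`;
`I 0 h` plays no role) and states `Z n h` (for `n ≥ 0`). -/
structure IsSystem {Ω : Type*} [MeasurableSpace Ω] (μ : Measure Ω) {N : ℕ} (α β q : ℝ)
    (f : ℝ → ℝ) (r : ℕ → ℝ) (I Z : ℕ → Fin N → Ω → ℝ) : Prop where
  measurable_init : ∀ h, Measurable (Z 0 h)
  measurable_action : ∀ n h, Measurable (I (n + 1) h)
  /-- the actions take values in `{0, 1}` -/
  action_mem : ∀ n h ω, I (n + 1) h ω = 0 ∨ I (n + 1) h ω = 1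
  /-- the states take values in `[0, 1]` -/
  state_mem : ∀ n h ω, Z n h ω ∈ Icc (0 : ℝ) 1
  /-- `r n ∼ 1 / n` -/
  weights : Tendsto (fun n : ℕ => (n : ℝ) * r n) atTop (𝓝 1)
  dynamics : ∀ n h ω, Z (n + 1) h ω = (1 - r n) * Z n h ω + r n * I (n + 1) h ω
  condIndep : ∀ n, CondIndepGiven μ (past I Z n) (I (n + 1))
  condProb : ∀ n h, μ⟦I (n + 1) h ⁻¹' {1}|past I Z n⟧ =ᵐ[μ]
    fun ω => α * avg (fun i => Z n i ω) + β * q + (1 - α - β) * f (Z n h ω)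

/-- The mean vector field `F` of the system. -/
noncomputable def field (N : ℕ) (α β q : ℝ) (f : ℝ → ℝ) (z : Fin N → ℝ) : Fin N → ℝ :=
  fun h => α * avg z + β * q + (1 - α - β) * f (z h) - z h

/-- The zero set of `F` in `[0, 1] ^ N`. -/
def zeroSet (N : ℕ) (α β q : ℝ) (f : ℝ → ℝ) : Set (Fin N → ℝ) :=
  {z | (∀ h, z h ∈ Icc (0 : ℝ) 1) ∧ field N α β q f z = 0}

/-- The synchronized vectors, that is those of the form `(t, …, t)` with `t ∈ [0, 1]`. -/
def IsSynchronized {N : ℕ} (z : Fin N → ℝ) : Prop :=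
  ∃ t ∈ Icc (0 : ℝ) 1, z = fun _ => t

/-- The function `φ` whose zeros give the synchronized zeros of `F`. -/
noncomputable def syncFun (α β q : ℝ) (f : ℝ → ℝ) (z : ℝ) : ℝ :=
  f z - (1 - α) / (1 - α - β) * z + β * q / (1 - α - β)

/-- The function `z ↦ f z - z / (1 - α - β) - c` has at most one zero in `[0, 1]`. -/
def AtMostOneZero (α β : ℝ) (f : ℝ → ℝ) (c : ℝ) : Prop :=
  {z | z ∈ Icc (0 : ℝ) 1 ∧ f z - 1 / (1 - α - β) * z - c = 0}.Subsingleton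

end ReinforcedSync

namespace ReinforcedSync

/-! The field is a gradient: since the interaction is a symmetric mean-field term and `f` has a
primitive `G`, one has `field = -∇V` with `V = potential`. The states follow the Robbins-Monro
scheme `Z (n+1) = Z n + r n * (field (Z n) + noise)`, whose noise is a martingale difference bounded
by 1.

Monotonicity of `f` makes `G` convex, which gives a descent inequality for `V` with a quadratic
error and no Lipschitz bound on `f` (`potential_le`). As `∑ r n ^ 2 < ∞`, the martingale sums that
appear converge almost surely (`ae_exists_tendsto_sum_mul`), so `∑ r n * |field (Z n)|² < ∞`. As `∑
r n = ∞`, an excursion argument then gives `field (Z n) → 0` (`tendsto_sum_sq_field`), so every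
cluster point is a zero of the field.

All zeros are synchronized, because their components solve one scalar equation with at most one root
(`isSynchronized_of_mem_zeroSet`). They are thus finite in number, and vanishing steps prevent
oscillation between two of them (`exists_tendsto_const_of_mapClusterPt`). -/

/-! ### Almost sure convergence of martingale sums -/

/-- Sums of martingale differences `a k * ξ k` with predictable `a k` bounded by a square-summable
sequence and `|ξ k| ≤ 1` converge almost surely. -/
theorem ae_exists_tendsto_sum_mul {Ω : Type*} {m0 : MeasurableSpace Ω} {μ : Measure Ω}
    [IsProbabilityMeasure μ] (ℱ : Filtration ℕ m0) {a ξ : ℕ → Ω → ℝ} {c : ℕ → ℝ}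
    (hc : Summable fun n => c n ^ 2) (ha : ∀ n, StronglyMeasurable[ℱ n] (a n))
    (hac : ∀ n ω, |a n ω| ≤ c n) (hξ : ∀ n, StronglyMeasurable[ℱ (n + 1)] (ξ n))
    (hξ1 : ∀ n ω, |ξ n ω| ≤ 1) (hcond : ∀ n, μ[ξ n|ℱ n] =ᵐ[μ] 0) :
    ∀ᵐ ω ∂μ, ∃ l, Tendsto (fun n => ∑ k ∈ Finset.range n, a k ω * ξ k ω) atTop (𝓝 l) := by
  set M : ℕ → Ω → ℝ := fun n ω => ∑ k ∈ Finset.range n, a k ω * ξ k ω with hM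
  have hD : ∀ n ω, |a n ω * ξ n ω| ≤ c n := fun n ω => by
    rw [abs_mul]
    calc |a n ω| * |ξ n ω| ≤ |a n ω| * 1 := by gcongr; exact hξ1 n ω
      _ ≤ c n := by rw [mul_one]; exact hac n ω
  have hMS : ∀ n ω, M (n + 1) ω = M n ω + a n ω * ξ n ω := fun n ω => by
    simp only [hM, Finset.sum_range_succ]
  have hMmeas : ∀ n, StronglyMeasurable[ℱ n] (M n) := by
    intro n
    refine Finset.stronglyMeasurable_fun_sum _ fun k hk => ?_
    have hk' : k + 1 ≤ n := Finset.mem_range.1 hk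
    exact ((ha k).mono (ℱ.mono (by omega))).mul ((hξ k).mono (ℱ.mono hk'))
  have hMbd : ∀ n ω, |M n ω| ≤ ∑ k ∈ Finset.range n, c k := fun n ω =>
    (Finset.abs_sum_le_sum_abs _ _).trans (Finset.sum_le_sum fun k _ => hD k ω)
  have bdd_int : ∀ (g : Ω → ℝ) (C : ℝ), StronglyMeasurable[m0] g → (∀ ω, |g ω| ≤ C) →
      Integrable g μ := fun g C hg hC =>
    Integrable.of_bound hg.aestronglyMeasurable C (Eventually.of_forall hC)
  have hξm : ∀ n, StronglyMeasurable[m0] (ξ n) := fun n => (hξ n).mono (ℱ.le _)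
  have ham : ∀ n, StronglyMeasurable[m0] (a n) := fun n => (ha n).mono (ℱ.le _)
  have hMm : ∀ n, StronglyMeasurable[m0] (M n) := fun n => (hMmeas n).mono (ℱ.le _)
  have hξint : ∀ n, Integrable (ξ n) μ := fun n => bdd_int _ 1 (hξm n) (hξ1 n)
  have hDint : ∀ n, Integrable (a n * ξ n) μ := fun n =>
    bdd_int _ (c n) ((ham n).mul (hξm n)) (hD n)
  have hDcond : ∀ n, μ[a n * ξ n|ℱ n] =ᵐ[μ] 0 := fun n => by
    filter_upwards [condExp_mul_of_stronglyMeasurable_left (ha n) (hDint n) (hξint n), hcond n]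
      with ω h1 h2
    rw [h1, Pi.mul_apply, h2]; simp
  have hMart : Martingale M ℱ μ := by
    refine martingale_of_condExp_sub_eq_zero_nat hMmeas
      (fun n => bdd_int _ _ (hMm n) (hMbd n)) fun n => ?_
    have : M (n + 1) - M n = a n * ξ n := by
      funext ω; simp [hMS]
    rw [this]; exact hDcond n
  have hint : ∀ n, Integrable (M n * (a n * ξ n)) μ := fun n => by
    refine bdd_int _ ((∑ k ∈ Finset.range n, c k) * c n)
      ((hMm n).mul ((ham n).mul (hξm n))) fun ω => ?_
    rw [Pi.mul_apply, abs_mul]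
    exact mul_le_mul (hMbd n ω) (hD n ω) (abs_nonneg _) ((abs_nonneg _).trans (hMbd n ω))
  -- Increments are orthogonal to the past, so second moments add up and are bounded by `∑ c k ^ 2`.
  have hcross : ∀ n, ∫ ω, M n ω * (a n ω * ξ n ω) ∂μ = 0 := fun n => by
    have h1 := condExp_mul_of_stronglyMeasurable_left (hMmeas n) (hint n) (hDint n)
    have h2 : μ[M n * (a n * ξ n)|ℱ n] =ᵐ[μ] 0 := by
      filter_upwards [h1, hDcond n] with ω h1 h2
      rw [h1, Pi.mul_apply, h2]; simp
    have h3 := integral_condExp (μ := μ) (f := M n * (a n * ξ n)) (ℱ.le n)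
    rw [integral_congr_ae h2] at h3
    simpa using h3.symm
  have hM2int : ∀ n, Integrable (fun ω => M n ω ^ 2) μ := fun n => by
    refine bdd_int _ ((∑ k ∈ Finset.range n, c k) ^ 2) ((hMm n).pow 2) fun ω => ?_
    rw [abs_pow]
    exact pow_le_pow_left₀ (abs_nonneg _) (hMbd n ω) 2
  have hM2 : ∀ n, ∫ ω, M n ω ^ 2 ∂μ ≤ ∑ k ∈ Finset.range n, c k ^ 2 := by
    intro n
    induction n with
    | zero => simp [hM]
    | succ n ih =>
      have hi' : Integrable (fun ω => 2 * (M n ω * (a n ω * ξ n ω))) μ := (hint n).const_mul 2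
      have hi : Integrable (fun ω => M n ω ^ 2 + 2 * (M n ω * (a n ω * ξ n ω))) μ :=
        (hM2int n).add hi'
      have hle : ∫ ω, M (n + 1) ω ^ 2 ∂μ ≤
          ∫ ω, (M n ω ^ 2 + 2 * (M n ω * (a n ω * ξ n ω)) + c n ^ 2) ∂μ := by
        refine integral_mono (hM2int _)
          (hi.add (integrable_const _)) fun ω => ?_
        have h := pow_le_pow_left₀ (abs_nonneg _) (hD n ω) 2
        rw [sq_abs] at h
        simp only [hMS]
        nlinarith
      rw [integral_add hi (integrable_const _),
        integral_add (hM2int n) hi', integral_const_mul, hcross n] at hle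
      rw [Finset.sum_range_succ]
      simp at hle
      linarith
  -- The L² bound gives the L¹ bound required by Doob's theorem, through `|x| ≤ 1 + x ^ 2`.
  refine hMart.submartingale.exists_ae_tendsto_of_bdd
    (R := (1 + ∑' k, c k ^ 2).toNNReal) fun n => ?_
  rw [eLpNorm_one_eq_lintegral_enorm,
    ← ofReal_integral_norm_eq_lintegral_enorm (bdd_int _ _ (hMm n) (hMbd n)), ENNReal.ofReal]
  norm_cast
  refine Real.toNNReal_le_toNNReal ?_
  calc ∫ ω, ‖M n ω‖ ∂μ ≤ ∫ ω, (1 + M n ω ^ 2) ∂μ := by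
        refine integral_mono (bdd_int _ _ (hMm n) (hMbd n)).norm
          ((integrable_const _).add (hM2int n)) fun ω => ?_
        simp only [Real.norm_eq_abs]
        rw [← sq_abs (M n ω)]
        nlinarith [sq_nonneg (|M n ω| - 1), abs_nonneg (M n ω)]
    _ = 1 + ∫ ω, M n ω ^ 2 ∂μ := by
        rw [integral_add (integrable_const _) (hM2int n)]; simp
    _ ≤ 1 + ∑' k, c k ^ 2 := by
        gcongr
        exact (hM2 n).trans (hc.sum_le_tsum _ fun k _ => sq_nonneg _)

/-! ### Pathwise stochastic approximation -/

/-- A noisy Robbins-Monro scheme along a field `F` with a Lyapunov function `V` in a compact set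
satisfies `F (x n) → 0`. -/
theorem tendsto_sum_sq_field {ι : Type*} [Fintype ι] {K : Set (ι → ℝ)} (hK : IsCompact K)
    {F : (ι → ℝ) → ι → ℝ} (hF : ContinuousOn F K) {V : (ι → ℝ) → ℝ} {b : ℝ}
    (hVb : ∀ z ∈ K, b ≤ V z)
    (hV : ∀ z ∈ K, ∀ w ∈ K,
      V w ≤ V z - ∑ h, F z h * (w h - z h) + ∑ h, (w h - z h) ^ 2)
    {x ξ : ℕ → ι → ℝ} {r : ℕ → ℝ} (hx : ∀ n, x n ∈ K) (hr : ∀ n, 0 ≤ r n)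
    (hr1 : ¬ Summable r) (hr2 : Summable fun n => r n ^ 2)
    (hstep : ∀ n h, x (n + 1) h = x n h + r n * (F (x n) h + ξ n h))
    (hbd : ∀ n h, |F (x n) h + ξ n h| ≤ 1)
    (hξ : ∀ h, ∃ l, Tendsto (fun n => ∑ k ∈ Finset.range n, r k * ξ k h) atTop (𝓝 l))
    (hFξ : ∀ h, ∃ l, Tendsto (fun n => ∑ k ∈ Finset.range n, r k * F (x k) h * ξ k h)
      atTop (𝓝 l)) :
    Tendsto (fun n => ∑ h, F (x n) h ^ 2) atTop (𝓝 0) := by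
  set Q : (ι → ℝ) → ℝ := fun z => ∑ h, F z h ^ 2 with hQ
  have hQ0 : ∀ z, 0 ≤ Q z := fun z => Finset.sum_nonneg fun h _ => sq_nonneg _
  have hFQ : ∀ z h, F z h ^ 2 ≤ Q z := fun z h =>
    Finset.single_le_sum (f := fun h => F z h ^ 2) (fun h _ => sq_nonneg _) (Finset.mem_univ h)
  have hQc : ContinuousOn Q K :=
    continuousOn_finsetSum _ fun h _ => ((continuous_apply h).comp_continuousOn hF).pow 2
  have hQu : UniformContinuousOn Q K := hK.uniformContinuousOn_of_continuous hQc
  have hdesc : ∀ n, r n * Q (x n) ≤ V (x n) - V (x (n + 1))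
      - ∑ h, r n * F (x n) h * ξ n h + Fintype.card ι * r n ^ 2 := by
    intro n
    have h1 := hV _ (hx n) _ (hx (n + 1))
    have h2 : ∑ h, F (x n) h * (x (n + 1) h - x n h)
        = r n * Q (x n) + ∑ h, r n * F (x n) h * ξ n h := by
      simp only [hQ, Finset.mul_sum, ← Finset.sum_add_distrib]
      refine Finset.sum_congr rfl fun h _ => ?_
      rw [hstep]; ring
    have h3 : ∑ h, (x (n + 1) h - x n h) ^ 2 ≤ Fintype.card ι * r n ^ 2 := by
      have : ∀ h ∈ Finset.univ, (x (n + 1) h - x n h) ^ 2 ≤ r n ^ 2 := fun h _ => by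
        rw [hstep, add_sub_cancel_left, mul_pow]
        have := (sq_le_one_iff_abs_le_one _).2 (hbd n h)
        nlinarith [sq_nonneg (r n)]
      simpa using Finset.sum_le_sum this
    linarith
  have hbddW : ∃ C, ∀ n, -C ≤ ∑ k ∈ Finset.range n, ∑ h, r k * F (x k) h * ξ k h := by
    choose l hl using hFξ
    have : Tendsto (fun n => ∑ k ∈ Finset.range n, ∑ h, r k * F (x k) h * ξ k h) atTop
        (𝓝 (∑ h, l h)) := by
      simp_rw [Finset.sum_comm (s := Finset.range _)]
      exact tendsto_finsetSum _ fun h _ => hl h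
    obtain ⟨C, hC⟩ := this.bddBelow_range
    exact ⟨-C, fun n => by simpa using hC ⟨n, rfl⟩⟩
  obtain ⟨C, hC⟩ := hbddW
  have hsum : Summable fun n => r n * Q (x n) := by
    refine summable_of_sum_range_le
      (c := V (x 0) - b + C + Fintype.card ι * ∑' k, r k ^ 2)
      (fun n => mul_nonneg (hr n) (hQ0 _)) fun n => ?_
    have h1 := Finset.sum_le_sum (s := Finset.range n) fun k _ => hdesc k
    rw [Finset.sum_add_distrib, Finset.sum_sub_distrib, Finset.sum_range_sub',
      ← Finset.mul_sum] at h1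
    have h2 := hr2.sum_le_tsum (Finset.range n) fun k _ => sq_nonneg _
    have h3 := hVb _ (hx n)
    have h4 := hC n
    have h5 : (Fintype.card ι : ℝ) * ∑ k ∈ Finset.range n, r k ^ 2
        ≤ Fintype.card ι * ∑' k, r k ^ 2 := by gcongr
    linarith
  -- Otherwise `Q ≥ 2κ` infinitely often. From a late enough such time `n`, the path stays within
  -- `ρ` of `x n` as long as `Q ≥ κ` has held, and closeness `ρ` in turn preserves `Q ≥ κ`. So `Q ≥
  -- κ` forever, and the finite sum of `r * Q` contradicts the divergence of `∑ r`.
  by_contra hnot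
  obtain ⟨κ, hκ, hfreq⟩ : ∃ κ > 0, ∃ᶠ n in atTop, 2 * κ ≤ Q (x n) := by
    by_contra! hcon
    refine hnot (Metric.tendsto_atTop.2 fun ε hε => ?_)
    obtain ⟨M, hM⟩ := eventually_atTop.1 (hcon (ε / 2) (by positivity))
    refine ⟨M, fun n hn => ?_⟩
    have h1 := hM n hn
    rw [Real.dist_eq, sub_zero, abs_of_nonneg (hQ0 _)]
    linarith
  obtain ⟨ρ, hρ, hclose⟩ := Metric.uniformContinuousOn_iff.1 hQu κ hκ
  -- When `Q ≥ κ`, `|F| ≤ 1 + F² ≤ Q / κ + Q`: the drift is controlled by the summable quantity `r *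
  -- Q`.
  set A : ℝ := 1 / κ + 1 with hA
  have hApos : 0 < A := by positivity
  have hFA : ∀ z, κ ≤ Q z → ∀ h, |F z h| ≤ A * Q z := by
    intro z hz h
    have h1 := hFQ z h
    rw [← sq_abs] at h1
    have h2 : 1 ≤ 1 / κ * Q z := by
      rw [one_div, inv_mul_eq_div, le_div_iff₀ hκ]; linarith
    have : A * Q z = 1 / κ * Q z + Q z := by rw [hA]; ring
    nlinarith [sq_nonneg (|F z h| - 1)]
  obtain ⟨M1, hM1⟩ := Metric.cauchySeq_iff.1 hsum.hasSum.tendsto_sum_nat.cauchySeq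
    (ρ / (4 * A)) (by positivity)
  have hM2 : ∀ h, ∃ M, ∀ m ≥ M, ∀ n ≥ M,
      dist (∑ k ∈ Finset.range m, r k * ξ k h) (∑ k ∈ Finset.range n, r k * ξ k h) < ρ / 4 :=
    fun h => Metric.cauchySeq_iff.1 (hξ h).choose_spec.cauchySeq (ρ / 4) (by positivity)
  choose M2 hM2 using hM2
  obtain ⟨n, hn, hnQ⟩ := frequently_atTop.1 hfreq (M1 ⊔ Finset.univ.sup M2)
  have hn1 : M1 ≤ n := le_sup_left.trans hn
  have hn2 : ∀ h, M2 h ≤ n := fun h =>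
    (Finset.le_sup (f := M2) (Finset.mem_univ h)).trans (le_sup_right.trans hn)
  have hS : ∀ j, ∑ k ∈ Finset.range j, r (n + k) * Q (x (n + k)) < ρ / (4 * A) := by
    intro j
    have h1 := hM1 (n + j) (by omega) n hn1
    rw [Real.dist_eq, Finset.sum_range_add, add_sub_cancel_left] at h1
    exact (le_abs_self _).trans_lt h1
  have hT : ∀ h j, |∑ k ∈ Finset.range j, r (n + k) * ξ (n + k) h| < ρ / 4 := by
    intro h j
    have h1 := hM2 h (n + j) (by have := hn2 h; omega) n (hn2 h)
    rwa [Real.dist_eq, Finset.sum_range_add, add_sub_cancel_left] at h1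
  have hpath : ∀ h j, x (n + j) h - x n h = ∑ k ∈ Finset.range j, r (n + k) * F (x (n + k)) h
      + ∑ k ∈ Finset.range j, r (n + k) * ξ (n + k) h := by
    intro h j
    induction j with
    | zero => simp
    | succ j ih =>
      rw [Finset.sum_range_succ, Finset.sum_range_succ, ← add_assoc, hstep]
      linarith
  have hall : ∀ j, κ ≤ Q (x (n + j)) := by
    intro j
    induction j using Nat.strong_induction_on with
    | _ j ih =>
      have hd : dist (x (n + j)) (x n) < ρ := by
        refine (dist_pi_lt_iff hρ).2 fun h => ?_
        rw [Real.dist_eq, hpath]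
        have h1 : |∑ k ∈ Finset.range j, r (n + k) * F (x (n + k)) h| ≤
            A * ∑ k ∈ Finset.range j, r (n + k) * Q (x (n + k)) := by
          rw [Finset.mul_sum]
          refine (Finset.abs_sum_le_sum_abs _ _).trans (Finset.sum_le_sum fun k hk => ?_)
          rw [abs_mul, abs_of_nonneg (hr _)]
          have := mul_le_mul_of_nonneg_left (hFA _ (ih k (Finset.mem_range.1 hk)) h) (hr (n + k))
          linarith
        have h2 : A * ∑ k ∈ Finset.range j, r (n + k) * Q (x (n + k)) ≤ A * (ρ / (4 * A)) := by
          gcongr; exact (hS j).le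
        have h3 : A * (ρ / (4 * A)) = ρ / 4 := by field_simp
        have h4 := hT h j
        have h5 := abs_add_le (∑ k ∈ Finset.range j, r (n + k) * F (x (n + k)) h)
          (∑ k ∈ Finset.range j, r (n + k) * ξ (n + k) h)
        linarith
      have h1 := hclose _ (hx (n + j)) _ (hx n) hd
      rw [Real.dist_eq, abs_lt] at h1
      linarith
  refine hr1 ((summable_nat_add_iff n).1 (summable_of_sum_range_le (c := ρ / (4 * A) / κ)
    (fun k => hr _) fun j => ?_))
  rw [le_div_iff₀ hκ, Finset.sum_mul]
  refine le_trans (Finset.sum_le_sum fun k _ => ?_) (hS j).le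
  rw [add_comm k n]
  exact mul_le_mul_of_nonneg_left (hall k) (hr _)

/-- A sequence in a compact set with vanishing steps, all of whose cluster points are constant
vectors with values in a finite set, converges. -/
theorem exists_tendsto_const_of_mapClusterPt {ι : Type*} [Fintype ι] [Nonempty ι]
    {K : Set (ι → ℝ)} (hK : IsCompact K) {T : Set ℝ} (hT : T.Finite) {x : ℕ → ι → ℝ}
    (hx : ∀ n, x n ∈ K) (hstep : ∀ h, Tendsto (fun n => x (n + 1) h - x n h) atTop (𝓝 0))
    (hcl : ∀ z ∈ K, MapClusterPt z atTop x → ∃ t ∈ T, z = fun _ => t) :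
    ∃ t ∈ T, Tendsto x atTop (𝓝 fun _ => t) := by
  obtain ⟨i⟩ := ‹Nonempty ι›
  -- Between two cluster levels the finite set `T` leaves a gap `[a, b]`. By compactness the path
  -- eventually avoids it, and steps shorter than `b - a` cannot jump over it.
  have key : ∀ s t : ℝ, s < t → MapClusterPt (fun _ => s) atTop x →
      ¬ MapClusterPt (fun _ => t) atTop x := by
    intro s t hst hs ht
    obtain ⟨a, ha, b, hb, hab, hTab⟩ : ∃ a, s < a ∧ ∃ b, b < t ∧ a < b ∧ ∀ u ∈ T, u ∉ Icc a b := by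
      have hne : (Ioo s t \ T).Nonempty := ((Ioo_infinite hst).sdiff hT).nonempty
      obtain ⟨p, hp, hpT⟩ := hne
      have hopen : IsOpen (Ioo s t \ T) := isOpen_Ioo.sdiff hT.isClosed
      obtain ⟨ε, hε, hball⟩ := Metric.isOpen_iff.1 hopen p ⟨hp, hpT⟩
      have hsub : Icc (p - ε / 2) (p + ε / 2) ⊆ Ioo s t \ T := fun u hu => hball (by
        rw [Metric.mem_ball, Real.dist_eq, abs_lt]; constructor <;> linarith [hu.1, hu.2])
      have h1 := hsub (left_mem_Icc.2 (by linarith))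
      have h2 := hsub (right_mem_Icc.2 (by linarith))
      exact ⟨_, h1.1.1, _, h2.1.2, by linarith, fun u hu hu' => (hsub hu').2 hu⟩
    have hout : ∀ᶠ n in atTop, x n i ∉ Icc a b := by
      by_contra hcon
      have hcomp : IsCompact (K ∩ (fun z : ι → ℝ => z i) ⁻¹' Icc a b) :=
        hK.inter_right (isClosed_Icc.preimage (continuous_apply i))
      obtain ⟨z, hz, hzc⟩ := hcomp.exists_mapClusterPt_of_frequently (f := x) (l := atTop)
        ((not_eventually.1 hcon).mono fun n hn => ⟨hx n, not_not.1 hn⟩)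
      obtain ⟨u, hu, rfl⟩ := hcl z hz.1 hzc
      exact hTab u hu hz.2
    have hsmall : ∀ᶠ n in atTop, x (n + 1) i - x n i < b - a :=
      (hstep i).eventually_lt_const (by linarith)
    have hfs : ∃ᶠ n in atTop, x n i < a :=
      hs.frequently ((continuous_apply i).continuousAt.eventually_lt_const ha)
    have hft : ∃ᶠ n in atTop, b < x n i :=
      ht.frequently ((continuous_apply i).continuousAt.eventually_const_lt hb)
    obtain ⟨M, hM⟩ := eventually_atTop.1 (hout.and hsmall)
    obtain ⟨n, hnM, hn⟩ := (frequently_atTop.1 hfs) M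
    have hstay : ∀ m ≥ n, x m i < a := by
      intro m hm
      induction m, hm using Nat.le_induction with
      | base => exact hn
      | succ m hm ih =>
        by_contra hcon
        have h1 := (hM m (hnM.trans hm)).2
        exact (hM (m + 1) (by omega)).1 ⟨not_lt.1 hcon, by linarith⟩
    obtain ⟨m, hmn, hm⟩ := (frequently_atTop.1 hft) n
    have := hstay m hmn
    linarith
  obtain ⟨z, hzK, hz⟩ := hK.exists_mapClusterPt_of_frequently (f := x) (l := atTop)
    (Frequently.of_forall hx)
  obtain ⟨t, ht, rfl⟩ := hcl z hzK hz
  refine ⟨t, ht, hK.tendsto_nhds_of_unique_mapClusterPt (Eventually.of_forall hx) ?_⟩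
  intro w hw hwc
  obtain ⟨s, -, rfl⟩ := hcl w hw hwc
  rcases lt_trichotomy s t with h | h | h
  · exact absurd hz (key s t h hwc)
  · rw [h]
  · exact absurd hwc (key t s h hz)

/-! ### The mean field: zeros, range and continuity -/

theorem avg_mem_Icc {N : ℕ} (hN : 0 < N) {z : Fin N → ℝ} (hz : ∀ h, z h ∈ Icc (0 : ℝ) 1) :
    avg z ∈ Icc (0 : ℝ) 1 := by
  have hN' : (0 : ℝ) < N := by exact_mod_cast hN
  refine ⟨div_nonneg (Finset.sum_nonneg fun i _ => (hz i).1) hN'.le, ?_⟩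
  rw [avg, div_le_one hN']
  simpa using Finset.sum_le_sum (s := Finset.univ) fun i _ => (hz i).2

theorem avg_const {N : ℕ} (hN : 0 < N) (t : ℝ) : avg (fun _ : Fin N => t) = t := by
  have hN' : (N : ℝ) ≠ 0 := by exact_mod_cast hN.ne'
  simp [avg, hN']

theorem eq_zero_of_avg_eq_zero {N : ℕ} (hN : 0 < N) {z : Fin N → ℝ} (hz : ∀ h, 0 ≤ z h)
    (h0 : avg z = 0) : z = fun _ => 0 := by
  have hN' : (N : ℝ) ≠ 0 := by exact_mod_cast hN.ne'
  rw [avg, div_eq_zero_iff, or_iff_left hN', Finset.sum_eq_zero_iff_of_nonneg fun i _ => hz i] at h0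
  exact funext fun i => h0 i (Finset.mem_univ i)

theorem eq_one_of_avg_eq_one {N : ℕ} (hN : 0 < N) {z : Fin N → ℝ} (hz : ∀ h, z h ≤ 1)
    (h1 : avg z = 1) : z = fun _ => 1 := by
  have hN' : (N : ℝ) ≠ 0 := by exact_mod_cast hN.ne'
  have h2 : avg (fun i => 1 - z i) = 0 := by
    rw [avg, div_eq_one_iff_eq hN'] at h1
    simp [avg, Finset.sum_sub_distrib, h1]
  have h3 := eq_zero_of_avg_eq_zero hN (fun i => sub_nonneg.2 (hz i)) h2
  exact funext fun i => by linarith [congrFun h3 i]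

/-- All components solve the scalar equation with the same `c = -s / (1 - α - β)`, where `s = α *
avg z + β * q` lies in `[0, α + β]`. The value `s = 0` forces `avg z = 0`, hence `z = 0`. The value
`s = α + β` forces `avg z = 1`, hence `z = 1`, unless `α = 0` and `q = 1`, the case covered by
`hc_end`. -/
theorem isSynchronized_of_mem_zeroSet {N : ℕ} (hN : 0 < N) {α β q : ℝ} (hα : 0 ≤ α) (hβ : 0 ≤ β)
    (hαβ : 0 < α + β) (hαβ' : α + β < 1) (hq : 0 < q) (hq' : q ≤ 1) {f : ℝ → ℝ}
    (hc : ∀ c ∈ Ioo (-((α + β) / (1 - α - β))) 0, AtMostOneZero α β f c)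
    (hc_end : α = 0 → q = 1 → AtMostOneZero α β f (-((α + β) / (1 - α - β))))
    {z : Fin N → ℝ} (hz : z ∈ zeroSet N α β q f) : IsSynchronized z := by
  obtain ⟨hz01, hz0⟩ := hz
  have hγ : 0 < 1 - α - β := by linarith
  have ha := avg_mem_Icc hN hz01
  set s := α * avg z + β * q with hs
  have hαz : α * avg z ≤ α := mul_le_of_le_one_right hα ha.2
  have hβq : β * q ≤ β := mul_le_of_le_one_right hβ hq'
  have hαz0 : 0 ≤ α * avg z := mul_nonneg hα ha.1
  have hβq0 : 0 ≤ β * q := mul_nonneg hβ hq.le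
  have hsync : AtMostOneZero α β f (-(s / (1 - α - β))) → IsSynchronized z := by
    intro h1
    have hmem : ∀ i, z i ∈ {x | x ∈ Icc (0 : ℝ) 1 ∧
        f x - 1 / (1 - α - β) * x - -(s / (1 - α - β)) = 0} := fun i => by
      refine ⟨hz01 i, ?_⟩
      have h2 := congrFun hz0 i
      simp only [field, Pi.zero_apply] at h2
      field_simp
      linarith
    exact ⟨z ⟨0, hN⟩, hz01 _, funext fun i => h1 (hmem i) (hmem _)⟩
  rcases eq_or_lt_of_le (show 0 ≤ s by positivity) with h0 | h0
  · have hβ0 : β = 0 := by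
      have : β * q = 0 := by linarith
      exact (mul_eq_zero.1 this).resolve_right hq.ne'
    have hα0 : α * avg z = 0 := by linarith
    have : avg z = 0 := (mul_eq_zero.1 hα0).resolve_left (by linarith)
    exact ⟨0, by simp, eq_zero_of_avg_eq_zero hN (fun h => (hz01 h).1) this⟩
  rcases eq_or_lt_of_le (show s ≤ α + β by linarith) with h1 | h1
  · by_cases hα0 : α = 0
    · have hq1 : β * q = β * 1 := by linarith
      rw [h1] at hsync
      exact hsync (hc_end hα0 (mul_left_cancel₀ (by linarith) hq1))
    · have : α * avg z = α * 1 := by linarith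
      exact ⟨1, by simp, eq_one_of_avg_eq_one hN (fun h => (hz01 h).2)
        (mul_left_cancel₀ hα0 this)⟩
  · refine hsync (hc _ ⟨?_, ?_⟩)
    · rw [neg_lt_neg_iff]; gcongr
    · rw [neg_lt_zero]; positivity

theorem syncFun_eq_zero_of_mem_zeroSet {N : ℕ} (hN : 0 < N) {α β q : ℝ} (hαβ' : α + β < 1)
    {f : ℝ → ℝ} {t : ℝ} (ht : (fun _ => t) ∈ zeroSet N α β q f) : syncFun α β q f t = 0 := by
  have h1 := congrFun ht.2 ⟨0, hN⟩
  simp only [field, avg_const hN, Pi.zero_apply] at h1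
  have hγ : 1 - α - β ≠ 0 := by linarith
  rw [syncFun]
  field_simp
  linarith

theorem field_add_mem_Icc {N : ℕ} (hN : 0 < N) {α β q : ℝ} (hα : 0 ≤ α) (hβ : 0 ≤ β)
    (hαβ' : α + β < 1) (hq : 0 ≤ q) (hq' : q ≤ 1) {f : ℝ → ℝ}
    (hf : MapsTo f (Icc 0 1) (Icc 0 1)) {z : Fin N → ℝ} (hz : ∀ h, z h ∈ Icc (0 : ℝ) 1)
    (h : Fin N) : field N α β q f z h + z h ∈ Icc (0 : ℝ) 1 := by
  have ha := avg_mem_Icc hN hz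
  have hγ : 0 ≤ 1 - α - β := by linarith
  have hfz := hf (hz h)
  have h1 := mul_le_of_le_one_right hα ha.2
  have h2 := mul_le_of_le_one_right hβ hq'
  have h3 := mul_le_of_le_one_right hγ hfz.2
  have h4 := mul_nonneg hα ha.1
  have h5 := mul_nonneg hβ hq
  have h6 := mul_nonneg hγ hfz.1
  simp only [field]
  constructor <;> linarith

theorem continuousOn_field {N : ℕ} {α β q : ℝ} {f : ℝ → ℝ} (hf : ContinuousOn f (Icc 0 1)) :
    ContinuousOn (field N α β q f) (univ.pi fun _ => Icc 0 1) := by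
  refine continuousOn_pi.2 fun h => ?_
  have hfh : ContinuousOn (fun z : Fin N → ℝ => f (z h)) (univ.pi fun _ => Icc 0 1) :=
    hf.comp (continuous_apply h).continuousOn fun z hz => hz h (mem_univ h)
  unfold field avg
  exact ((Continuous.continuousOn (by fun_prop)).add (hfh.const_mul _)).sub
    (continuous_apply h).continuousOn

/-! ### The Lyapunov function -/

/-- The potential of the vector field `field N α β q f`, for a primitive `G` of `f`. -/
noncomputable def potential (N : ℕ) (α β q : ℝ) (G : ℝ → ℝ) (z : Fin N → ℝ) : ℝ :=
  ∑ h, z h ^ 2 / 2 - β * q * ∑ h, z h - α / (2 * N) * (∑ h, z h) ^ 2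
    - (1 - α - β) * ∑ h, G (z h)

/-- Tangent-line inequality for the convex function `G`: by the mean value theorem, its slope
between `a` and `b` is a value of `f` in between. -/
theorem mul_sub_le_sub_of_monotoneOn_deriv {s : Set ℝ} [hs : s.OrdConnected] {f G : ℝ → ℝ}
    (hf : MonotoneOn f s) (hG : ∀ x ∈ s, HasDerivWithinAt G (f x) s x) {a b : ℝ}
    (ha : a ∈ s) (hb : b ∈ s) : f a * (b - a) ≤ G b - G a := by
  have key : ∀ u ∈ s, ∀ v ∈ s, u < v → ∃ c ∈ Ioo u v, G v - G u = f c * (v - u) := by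
    intro u hu v hv huv
    have hsub : Icc u v ⊆ s := hs.out hu hv
    obtain ⟨c, hc, h⟩ := exists_hasDerivAt_eq_slope G f huv
      (fun x hx => ((hG x (hsub hx)).mono hsub).continuousWithinAt)
      (fun x hx => ((hG x (hsub (Ioo_subset_Icc_self hx))).mono hsub).hasDerivAt
        (Icc_mem_nhds hx.1 hx.2))
    refine ⟨c, hc, ?_⟩
    have : v - u ≠ 0 := by linarith
    rw [h]; field_simp
  rcases lt_trichotomy a b with h | rfl | h
  · obtain ⟨c, hc, h1⟩ := key a ha b hb h
    rw [h1]
    have := hf ha (hs.out ha hb (Ioo_subset_Icc_self hc)) hc.1.le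
    nlinarith
  · simp
  · obtain ⟨c, hc, h1⟩ := key b hb a ha h
    have := hf (hs.out hb ha (Ioo_subset_Icc_self hc)) ha hc.2.le
    nlinarith

/-- The terms in `G` and in `(∑ z h) ^ 2` are concave, so they lie below their tangents. Only `∑ z h
^ 2 / 2` contributes a positive second-order error. -/
theorem potential_le {N : ℕ} {α β q : ℝ} (hα : 0 ≤ α)
    (hαβ' : α + β < 1) {f G : ℝ → ℝ} (hf : MonotoneOn f (Icc 0 1))
    (hG : ∀ x ∈ Icc (0 : ℝ) 1, HasDerivWithinAt G (f x) (Icc 0 1) x) {z w : Fin N → ℝ}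
    (hz : ∀ h, z h ∈ Icc (0 : ℝ) 1) (hw : ∀ h, w h ∈ Icc (0 : ℝ) 1) :
    potential N α β q G w ≤ potential N α β q G z
      - ∑ h, field N α β q f z h * (w h - z h) + ∑ h, (w h - z h) ^ 2 := by
  have h1 : ∑ h, f (z h) * (w h - z h) ≤ ∑ h, G (w h) - ∑ h, G (z h) := by
    rw [← Finset.sum_sub_distrib]
    exact Finset.sum_le_sum fun h _ => mul_sub_le_sub_of_monotoneOn_deriv hf hG (hz h) (hw h)
  have h2 := mul_le_mul_of_nonneg_left h1 (show 0 ≤ 1 - α - β by linarith)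
  have h3 : ∑ h, field N α β q f z h * (w h - z h) = (α * avg z + β * q) * (∑ h, w h - ∑ h, z h)
      + (1 - α - β) * ∑ h, f (z h) * (w h - z h) - ∑ h, z h * (w h - z h) := by
    rw [← Finset.sum_sub_distrib, Finset.mul_sum, Finset.mul_sum, ← Finset.sum_add_distrib,
      ← Finset.sum_sub_distrib]
    refine Finset.sum_congr rfl fun h _ => ?_
    simp only [field]; ring
  have h4 : ∑ h, w h ^ 2 / 2 - ∑ h, z h ^ 2 / 2 - ∑ h, z h * (w h - z h)
      = ∑ h, (w h - z h) ^ 2 / 2 := by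
    rw [← Finset.sum_sub_distrib, ← Finset.sum_sub_distrib]
    exact Finset.sum_congr rfl fun h _ => by ring
  have h5 : ∑ h, (w h - z h) ^ 2 / 2 ≤ ∑ h, (w h - z h) ^ 2 :=
    Finset.sum_le_sum fun h _ => half_le_self (sq_nonneg _)
  have h6 : α * avg z = 2 * (α / (2 * N)) * ∑ h, z h := by
    rw [avg]; ring
  have h7 : 0 ≤ α / (2 * N) * (∑ h, w h - ∑ h, z h) ^ 2 := by positivity
  rw [h3, h6]
  unfold potential
  nlinarith

theorem bddBelow_potential (N : ℕ) (α β q : ℝ) {G : ℝ → ℝ}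
    (hG : ContinuousOn G (Icc 0 1)) :
    ∃ b, ∀ z ∈ univ.pi fun _ : Fin N => Icc (0 : ℝ) 1, b ≤ potential N α β q G z := by
  have hc : ContinuousOn (potential N α β q G) (univ.pi fun _ => Icc 0 1) := by
    unfold potential
    refine (Continuous.continuousOn (by fun_prop)).sub
      ((continuousOn_finsetSum _ fun h _ => ?_).const_mul _)
    exact hG.comp (continuous_apply h).continuousOn fun z hz => hz h (mem_univ h)
  obtain ⟨b, hb⟩ := ((isCompact_univ_pi fun _ => isCompact_Icc).image_of_continuousOn hc).bddBelow
  exact ⟨b, fun z hz => hb (mem_image_of_mem _ hz)⟩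

/-! ### Summability of the weights -/

section Weights

variable {r : ℕ → ℝ}

/-- Comparison with `1 / n`, the source of both `∑ r n = ∞` and `∑ r n ^ 2 < ∞`. -/
theorem eventually_weights_bounds (hr : Tendsto (fun n : ℕ => (n : ℝ) * r n) atTop (𝓝 1)) :
    ∀ᶠ n : ℕ in atTop, 1 / 2 * (1 / (n : ℝ)) ≤ r n ∧ r n ≤ 2 * (1 / (n : ℝ)) := by
  filter_upwards [hr.eventually_const_le (show (1 / 2 : ℝ) < 1 by norm_num),
    hr.eventually_le_const (show (1 : ℝ) < 2 by norm_num), eventually_gt_atTop 0] with n h1 h2 hn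
  have hn' : (0 : ℝ) < n := by exact_mod_cast hn
  rw [mul_one_div, mul_one_div, div_le_iff₀ hn', le_div_iff₀ hn']
  constructor <;> linarith

theorem eventually_weights_nonneg (hr : Tendsto (fun n : ℕ => (n : ℝ) * r n) atTop (𝓝 1)) :
    ∀ᶠ n in atTop, 0 ≤ r n :=
  (eventually_weights_bounds hr).mono fun n h => le_trans (by positivity) h.1

theorem summable_weights_sq (hr : Tendsto (fun n : ℕ => (n : ℝ) * r n) atTop (𝓝 1)) :
    Summable fun n => r n ^ 2 := by
  refine Summable.of_norm_bounded_eventually_nat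
    ((Real.summable_one_div_nat_pow.2 one_lt_two).mul_left 4) ?_
  filter_upwards [eventually_weights_bounds hr, eventually_weights_nonneg hr] with n h h0
  rw [Real.norm_of_nonneg (sq_nonneg _)]
  calc r n ^ 2 ≤ (2 * (1 / (n : ℝ))) ^ 2 := pow_le_pow_left₀ h0 h.2 2
    _ = 4 * (1 / (n : ℝ) ^ 2) := by ring

theorem not_summable_weights (hr : Tendsto (fun n : ℕ => (n : ℝ) * r n) atTop (𝓝 1)) :
    ¬ Summable r := by
  intro h
  refine Real.not_summable_one_div_natCast ?_
  refine Summable.of_norm_bounded_eventually_nat (h.mul_left 2) ?_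
  filter_upwards [eventually_weights_bounds hr] with n h
  rw [Real.norm_of_nonneg (by positivity)]
  linarith [h.1]

end Weights

/-! ### Measurability, noise and convergence of the system -/

section System

variable {Ω : Type*} [m0 : MeasurableSpace Ω] {μ : Measure Ω} {N : ℕ} {α β q : ℝ}
  {f : ℝ → ℝ} {r : ℕ → ℝ} {I Z : ℕ → Fin N → Ω → ℝ}

/-- The filtration generated by the initial states and the actions. -/
def IsSystem.filtration (hsys : IsSystem μ α β q f r I Z) : Filtration ℕ m0 where
  seq := past I Z
  mono' m n hmn := sup_le_sup le_rfl
    (biSup_mono fun _ hk => Icc_subset_Icc_right hmn hk)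
  le' n := by
    refine sup_le (iSup_le fun h => (hsys.measurable_init h).comap_le)
      (iSup₂_le fun k hk => iSup_le fun h => ?_)
    obtain ⟨j, rfl⟩ := Nat.exists_eq_add_of_le' hk.1
    exact (hsys.measurable_action j h).comap_le

theorem IsSystem.measurable_action_filtration (hsys : IsSystem μ α β q f r I Z) (n : ℕ)
    (h : Fin N) : Measurable[hsys.filtration (n + 1)] (I (n + 1) h) := by
  rw [measurable_iff_comap_le]
  have hk : n + 1 ∈ Set.Icc 1 (n + 1) := ⟨by omega, le_rfl⟩
  exact ((le_iSup (fun h => MeasurableSpace.comap (I (n + 1) h) inferInstance) h).trans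
    (le_iSup₂_of_le (n + 1) hk le_rfl)).trans le_sup_right

theorem IsSystem.measurable_state (hsys : IsSystem μ α β q f r I Z) (n : ℕ) (h : Fin N) :
    Measurable[hsys.filtration n] (Z n h) := by
  induction n with
  | zero =>
    rw [measurable_iff_comap_le]
    exact (le_iSup (fun h => MeasurableSpace.comap (Z 0 h) inferInstance) h).trans le_sup_left
  | succ n ih =>
    have h1 : Measurable[hsys.filtration (n + 1)] (Z n h) :=
      ih.mono (hsys.filtration.mono n.le_succ) le_rfl
    have h2 := hsys.measurable_action_filtration n h
    have h3 : Z (n + 1) h = fun ω => (1 - r n) * Z n h ω + r n * I (n + 1) h ω :=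
      funext fun ω => hsys.dynamics n h ω
    rw [h3]
    exact (h1.const_mul _).add (h2.const_mul _)

theorem IsSystem.measurable_field (hsys : IsSystem μ α β q f r I Z)
    (hf : ContinuousOn f (Icc 0 1)) (n : ℕ) (h : Fin N) :
    Measurable[hsys.filtration n] fun ω => field N α β q f (fun i => Z n i ω) h := by
  -- Continuity of `f` is known only on `[0, 1]`; its extension is continuous on `ℝ` and agrees with
  -- `f` at the states.
  have hg : Continuous (IccExtend zero_le_one ((Icc (0 : ℝ) 1).domRestrict f)) :=
    (continuousOn_iff_continuous_domRestrict.1 hf).Icc_extend'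
  have h1 : Measurable[hsys.filtration n] fun ω => f (Z n h ω) := by
    have : (fun ω => f (Z n h ω)) =
        fun ω => IccExtend zero_le_one ((Icc (0 : ℝ) 1).domRestrict f) (Z n h ω) :=
      funext fun ω => by rw [IccExtend_of_mem _ _ (hsys.state_mem n h ω)]; rfl
    rw [this]
    exact hg.measurable.comp (hsys.measurable_state n h)
  have h2 : Measurable[hsys.filtration n] fun ω => ∑ i, Z n i ω :=
    Finset.measurable_fun_sum _ fun i _ => hsys.measurable_state n i
  unfold field avg
  exact ((((h2.div_const _).const_mul _).add_const _).add (h1.const_mul _)).sub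
    (hsys.measurable_state n h)

/-- The martingale differences driving the system. -/
noncomputable def noise (α β q : ℝ) (f : ℝ → ℝ) (I Z : ℕ → Fin N → Ω → ℝ) (n : ℕ) (h : Fin N)
    (ω : Ω) : ℝ :=
  I (n + 1) h ω - (field N α β q f (fun i => Z n i ω) h + Z n h ω)

theorem IsSystem.condExp_noise [IsProbabilityMeasure μ] (hsys : IsSystem μ α β q f r I Z)
    (hN : 0 < N) (hα : 0 ≤ α) (hβ : 0 ≤ β) (hαβ' : α + β < 1) (hq : 0 ≤ q) (hq' : q ≤ 1)
    (hf_mem : MapsTo f (Icc 0 1) (Icc 0 1)) (hf : ContinuousOn f (Icc 0 1)) (n : ℕ)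
    (h : Fin N) : μ[noise α β q f I Z n h|hsys.filtration n] =ᵐ[μ] 0 := by
  set p : Ω → ℝ := fun ω => field N α β q f (fun i => Z n i ω) h + Z n h ω with hp
  have hpm : Measurable[hsys.filtration n] p :=
    (hsys.measurable_field hf n h).add (hsys.measurable_state n h)
  have hpi : Integrable p μ := by
    refine Integrable.of_bound
      (hpm.mono (hsys.filtration.le n) le_rfl).aestronglyMeasurable 1
      (Eventually.of_forall fun ω => ?_)
    have := field_add_mem_Icc hN hα hβ hαβ' hq hq' hf_mem (fun i => hsys.state_mem n i ω) h
    rw [Real.norm_of_nonneg this.1]; exact this.2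
  have hI : I (n + 1) h = (I (n + 1) h ⁻¹' {1}).indicator fun _ => (1 : ℝ) := by
    funext ω
    rcases hsys.action_mem n h ω with h0 | h0 <;> simp [indicator, h0]
  have hIi : Integrable (I (n + 1) h) μ := by
    rw [hI]
    exact (integrable_const _).indicator
      (hsys.measurable_action n h (measurableSet_singleton 1))
  have h1 : μ[I (n + 1) h|hsys.filtration n] =ᵐ[μ] p := by
    rw [hI]
    refine (hsys.condProb n h).trans (Eventually.of_forall fun ω => ?_)
    simp only [hp, field]; ring
  have h2 : noise α β q f I Z n h = I (n + 1) h - p := rfl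
  rw [h2]
  filter_upwards [condExp_sub hIi hpi (hsys.filtration n), h1] with ω h3 h4
  rw [h3, Pi.sub_apply, h4,
    condExp_of_stronglyMeasurable (hsys.filtration.le n) hpm.stronglyMeasurable hpi]
  simp

theorem exists_tendsto_sum_shift {u : ℕ → ℝ} (m : ℕ)
    (hu : ∃ l, Tendsto (fun n => ∑ k ∈ Finset.range n, u k) atTop (𝓝 l)) :
    ∃ l, Tendsto (fun n => ∑ k ∈ Finset.range n, u (k + m)) atTop (𝓝 l) := by
  obtain ⟨l, hl⟩ := hu
  refine ⟨l - ∑ k ∈ Finset.range m, u k,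
    (((tendsto_add_atTop_iff_nat m).2 hl).sub_const _).congr fun n => ?_⟩
  rw [add_comm n m, Finset.sum_range_add, add_sub_cancel_left]
  exact Finset.sum_congr rfl fun k _ => by rw [add_comm]

/-- The states converge almost surely to a synchronized zero of the mean field. -/
theorem IsSystem.ae_exists_tendsto [IsProbabilityMeasure μ] (hsys : IsSystem μ α β q f r I Z)
    (hN : 0 < N) (hα : 0 ≤ α) (hβ : 0 ≤ β) (hαβ' : α + β < 1) (hq : 0 ≤ q) (hq' : q ≤ 1)
    (hf_mem : MapsTo f (Icc 0 1) (Icc 0 1)) (hf_mono : MonotoneOn f (Icc 0 1))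
    (hf : ContinuousOn f (Icc 0 1))
    (hprim : ∃ G : ℝ → ℝ, ∀ x ∈ Icc (0 : ℝ) 1, HasDerivWithinAt G (f x) (Icc 0 1) x)
    {T : Set ℝ} (hT : T.Finite) (hzero : ∀ z ∈ zeroSet N α β q f, ∃ t ∈ T, z = fun _ => t) :
    ∀ᵐ ω ∂μ, ∃ t ∈ T, Tendsto (fun n => fun h => Z n h ω) atTop (𝓝 fun _ => t) := by
  obtain ⟨G, hG⟩ := hprim
  have hr := hsys.weights
  have hr2 := summable_weights_sq hr
  have hr2' : Summable fun n => |r n| ^ 2 := by simpa only [sq_abs] using hr2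
  have hp : ∀ n h ω, field N α β q f (fun i => Z n i ω) h + Z n h ω ∈ Icc (0 : ℝ) 1 :=
    fun n h ω => field_add_mem_Icc hN hα hβ hαβ' hq hq' hf_mem (fun i => hsys.state_mem n i ω) h
  have hI : ∀ n h ω, I (n + 1) h ω ∈ Icc (0 : ℝ) 1 := fun n h ω => by
    rcases hsys.action_mem n h ω with h0 | h0 <;> simp [h0]
  have hξm : ∀ n h, StronglyMeasurable[hsys.filtration (n + 1)] (noise α β q f I Z n h) :=
    fun n h => ((hsys.measurable_action_filtration n h).sub
      (((hsys.measurable_field hf n h).add (hsys.measurable_state n h)).mono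
        (hsys.filtration.mono n.le_succ) le_rfl)).stronglyMeasurable
  have hξ1 : ∀ n h ω, |noise α β q f I Z n h ω| ≤ 1 := fun n h ω => by
    have h1 := hp n h ω
    have h2 := hI n h ω
    rw [noise, abs_le]
    constructor <;> linarith [h1.1, h1.2, h2.1, h2.2]
  have hcond : ∀ n h, μ[noise α β q f I Z n h|hsys.filtration n] =ᵐ[μ] 0 := fun n h =>
    hsys.condExp_noise hN hα hβ hαβ' hq hq' hf_mem hf n h
  have hA : ∀ᵐ ω ∂μ, ∀ h, ∃ l, Tendsto (fun n => ∑ k ∈ Finset.range n,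
      r k * noise α β q f I Z k h ω) atTop (𝓝 l) :=
    ae_all_iff.2 fun h => ae_exists_tendsto_sum_mul hsys.filtration (a := fun n _ => r n) hr2'
      (fun n => stronglyMeasurable_const) (fun n ω => le_rfl) (hξm · h) (hξ1 · h) (hcond · h)
  -- This series is the noise contribution to the variation of the potential, while the previous one
  -- controls the displacement of the path.
  have hB : ∀ᵐ ω ∂μ, ∀ h, ∃ l, Tendsto (fun n => ∑ k ∈ Finset.range n,
      r k * field N α β q f (fun i => Z k i ω) h * noise α β q f I Z k h ω) atTop (𝓝 l) :=
    ae_all_iff.2 fun h => ae_exists_tendsto_sum_mul hsys.filtration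
      (a := fun n ω => r n * field N α β q f (fun i => Z n i ω) h) hr2'
      (fun n => ((hsys.measurable_field hf n h).const_mul _).stronglyMeasurable)
      (fun n ω => by
        rw [abs_mul]
        refine mul_le_of_le_one_right (abs_nonneg _) (abs_le.2 ?_)
        have h1 := hp n h ω
        have h2 := hsys.state_mem n h ω
        constructor <;> linarith [h1.1, h1.2, h2.1, h2.2]) (hξm · h) (hξ1 · h) (hcond · h)
  filter_upwards [hA, hB] with ω hAω hBω
  -- The weights are nonnegative only from some time `m` on, so the scheme is restarted there.
  obtain ⟨m, hm⟩ := eventually_atTop.1 (eventually_weights_nonneg hr)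
  set K : Set (Fin N → ℝ) := univ.pi fun _ => Icc 0 1 with hKdef
  have hK : IsCompact K := isCompact_univ_pi fun _ => isCompact_Icc
  have hKmem : ∀ {z}, z ∈ K → ∀ h, z h ∈ Icc (0 : ℝ) 1 := fun hz h => hz h (mem_univ h)
  have hF : ContinuousOn (field N α β q f) K := continuousOn_field hf
  have hxK : ∀ n, (fun h => Z n h ω) ∈ K := fun n h _ => hsys.state_mem n h ω
  have hstep : ∀ n h, Z (n + 1) h ω = Z n h ω
      + r n * (field N α β q f (fun i => Z n i ω) h + noise α β q f I Z n h ω) := fun n h => by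
    rw [hsys.dynamics, noise]; ring
  have hbd : ∀ n h, |field N α β q f (fun i => Z n i ω) h + noise α β q f I Z n h ω| ≤ 1 :=
    fun n h => by
      have h1 := hsys.state_mem n h ω
      have h2 := hI n h ω
      rw [noise, abs_le]
      constructor <;> linarith [h1.1, h1.2, h2.1, h2.2]
  obtain ⟨b, hb⟩ := bddBelow_potential N α β q fun x hx => (hG x hx).continuousWithinAt
  have hQ : Tendsto (fun n => ∑ h, field N α β q f (fun i => Z n i ω) h ^ 2) atTop (𝓝 0) := by
    refine (tendsto_add_atTop_iff_nat m).1 (tendsto_sum_sq_field hK hF hb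
      (fun z hz w hw => potential_le hα hαβ' hf_mono hG (hKmem hz) (hKmem hw))
      (x := fun n h => Z (n + m) h ω) (ξ := fun n h => noise α β q f I Z (n + m) h ω)
      (r := fun n => r (n + m)) (fun n => hxK _) (fun n => hm _ (by omega))
      (fun h => not_summable_weights hr ((summable_nat_add_iff m).1 h))
      ((summable_nat_add_iff m).2 hr2) (fun n h => ?_) (fun n h => hbd _ h)
      (fun h => exists_tendsto_sum_shift m (hAω h)) (fun h => exists_tendsto_sum_shift m (hBω h)))
    simp only [add_right_comm n 1 m, hstep]
  have : Nonempty (Fin N) := ⟨⟨0, hN⟩⟩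
  refine exists_tendsto_const_of_mapClusterPt hK hT hxK (fun h => ?_) fun z hz hcl => ?_
  · have hr0 : Tendsto (fun n => |r n|) atTop (𝓝 0) := by
      have := hr2'.tendsto_atTop_zero.sqrt
      simpa only [Real.sqrt_sq (abs_nonneg _), Real.sqrt_zero] using this
    refine squeeze_zero_norm (fun n => ?_) hr0
    simp only [hstep, add_sub_cancel_left]
    rw [Real.norm_eq_abs, abs_mul]
    exact mul_le_of_le_one_right (abs_nonneg _) (hbd n h)
  · refine hzero z ⟨hKmem hz, ?_⟩
    have hQc : ContinuousOn (fun z => ∑ h, field N α β q f z h ^ 2) K :=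
      continuousOn_finsetSum _ fun h _ => ((continuous_apply h).comp_continuousOn hF).pow 2
    have hQz : ∑ h, field N α β q f z h ^ 2 = 0 := by
      by_contra hne
      have hpos : 0 < ∑ h, field N α β q f z h ^ 2 :=
        lt_of_le_of_ne (Finset.sum_nonneg fun h _ => sq_nonneg _) (Ne.symm hne)
      have h1 := (hQc z hz).eventually_const_lt (half_lt_self hpos)
      rw [eventually_nhdsWithin_iff] at h1
      have h2 := (hcl.frequently h1).and_eventually
        (hQ.eventually_lt_const (half_pos hpos))
      obtain ⟨n, h3, h4⟩ := h2.exists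
      exact lt_asymm (h3 (hxK n)) h4
    rw [Finset.sum_eq_zero_iff_of_nonneg fun h _ => sq_nonneg _] at hQz
    exact funext fun h => pow_eq_zero_iff two_ne_zero |>.1 (hQz h (Finset.mem_univ h))

end System

end ReinforcedSync

/-! ### The main theorem -/

open ReinforcedSync in
theorem theorem2p2 {Ω : Type*} [MeasurableSpace Ω] (μ : Measure Ω) [IsProbabilityMeasure μ]
    (N : ℕ) (hN : 2 ≤ N) (α β q : ℝ) (hα : 0 ≤ α) (hβ : 0 ≤ β) (hαβ : 0 < α + β)
    (hαβ' : α + β < 1) (hq : 0 < q) (hq' : q ≤ 1)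
    (f : ℝ → ℝ) (hf_mem : MapsTo f (Icc 0 1) (Icc 0 1)) (hf_mono : StrictMonoOn f (Icc 0 1))
    (hf_diff : ContDiffOn ℝ 1 f (Icc 0 1))
    (r : ℕ → ℝ) (I Z : ℕ → Fin N → Ω → ℝ)
    (hsys : ReinforcedSync.IsSystem μ α β q f r I Z)
    (hfin : {z | z ∈ ReinforcedSync.zeroSet N α β q f ∧
      ReinforcedSync.IsSynchronized z}.Finite)
    (hprim : ∃ G : ℝ → ℝ, ∀ x ∈ Icc (0 : ℝ) 1, HasDerivWithinAt G (f x) (Icc 0 1) x)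
    (hc : ∀ c ∈ Ioo (-((α + β) / (1 - α - β))) 0, ReinforcedSync.AtMostOneZero α β f c)
    (hc_end : α = 0 → q = 1 → ReinforcedSync.AtMostOneZero α β f (-((α + β) / (1 - α - β)))) :
    (∀ z ∈ ReinforcedSync.zeroSet N α β q f, ReinforcedSync.IsSynchronized z) ∧
    ∃ Zinf : Ω → ℝ, Measurable Zinf ∧
      (∀ ω, Zinf ω ∈ Icc (0 : ℝ) 1 ∧ ReinforcedSync.syncFun α β q f (Zinf ω) = 0) ∧
      ∀ᵐ ω ∂μ, Tendsto (fun n => fun h => Z n h ω) atTop (𝓝 (fun _ => Zinf ω)) := by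
  have hN0 : 0 < N := by omega
  have hsync : ∀ z ∈ zeroSet N α β q f, IsSynchronized z := fun z hz =>
    isSynchronized_of_mem_zeroSet hN0 hα hβ hαβ hαβ' hq hq' hc hc_end hz
  refine ⟨hsync, ?_⟩
  set T : Set ℝ := {t | (fun _ => t) ∈ zeroSet N α β q f} with hTdef
  have hT : T.Finite := by
    refine Set.Finite.of_injOn (f := fun t : ℝ => (fun _ : Fin N => t)) (fun t ht => ?_)
      (fun s _ t _ hst => congrFun hst ⟨0, hN0⟩) hfin
    exact ⟨ht, hsync _ ht⟩
  have hzero : ∀ z ∈ zeroSet N α β q f, ∃ t ∈ T, z = fun _ => t := fun z hz => by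
    obtain ⟨t, -, rfl⟩ := hsync z hz
    exact ⟨t, hz, rfl⟩
  have hae := hsys.ae_exists_tendsto hN0 hα hβ hαβ' hq.le hq' hf_mem hf_mono.monotoneOn
    hf_diff.continuousOn hprim hT hzero
  -- An almost sure event is nonempty, so `T` has a point. It serves as the value of the limit where
  -- `g` leaves `T`, which makes the pointwise claims hold for every `ω`.
  obtain ⟨_, t₀, ht₀, -⟩ := hae.exists
  have hZm : ∀ n, Measurable (Z n ⟨0, hN0⟩) := fun n =>
    (hsys.measurable_state n _).mono (hsys.filtration.le n) le_rfl
  obtain ⟨g, hg, hgl⟩ := measurable_limit_of_tendsto_metrizable_ae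
    (fun n => (hZm n).aemeasurable (μ := μ)) (hae.mono fun ω ⟨t, _, h⟩ =>
      ⟨t, ((continuous_apply (⟨0, hN0⟩ : Fin N)).tendsto _).comp h⟩)
  classical
  refine ⟨fun ω => if g ω ∈ T then g ω else t₀,
    Measurable.ite (hg hT.measurableSet) hg measurable_const, fun ω => ?_, ?_⟩
  · have hmem : (if g ω ∈ T then g ω else t₀) ∈ T := by
      split_ifs with h
      exacts [h, ht₀]
    exact ⟨hmem.1 ⟨0, hN0⟩, syncFun_eq_zero_of_mem_zeroSet hN0 hαβ' hmem⟩
  · filter_upwards [hae, hgl] with ω h1 h2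
    obtain ⟨t, ht, h3⟩ := h1
    have hgt : g ω = t := tendsto_nhds_unique h2
      (((continuous_apply (⟨0, hN0⟩ : Fin N)).tendsto _).comp h3)
    rw [hgt, if_pos ht]
    exact h3
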